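/- Let $n\ge 0$ be an integer and let $\omega=(\omega_1,\dots,\omega_n)\in\mathbb R^n$ be nonresonant, i.e. $\langle q,\omega\rangle\ne 0$ for all $q\in\mathbb Z^n\setminus\{0\}$. Let $\mathcal F=\mathbb C[[z_1,\dots,z_n,\bar z_1,\dots,\bar z_n]]$ be the ring of formal power series $H=\sum_{k,\bar k\in\mathbb Z_{\ge0}^n}H_{k,\bar k}\,z^k\bar z^{\bar k}$ in $2n$ independent variables, and let $\mathcal F_\diamond\subset\mathcal F$ be the subspace of series all of whose terms have total degree at least $3$. For $r>0$ put $D_r=\{(z,\bar z)\in\mathbb C^{2n}:|z_j|<r,\ |\bar z_j|<r,\ 1\le j\le n\}$, and let $\mathcal A^r\subset\mathcal F$ be the space of series that converge on $D_r$ to a function with $\sup_{D_r}|H|<\infty$. Let $$\{F,G\}=i\sum_{j=1}^n\big(\partial_{\bar z_j}F\,\partial_{z_j}G-\partial_{z_j}F\,\partial_{\bar z_j}G\big),\qquad H_2=\sum_{j=1}^n\omega_jz_j\bar z_j,\qquad \xi H=-i\sum_{k,\bar k}\operatorname{sign}\big(\langle\omega,\bar k-k\rangle\big)\,H_{k,\bar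 k}\,z^k\bar z^{\bar k}.$$ Let $\rho>0$ and $\widehat H_\diamond\in\mathcal A^\rho\cap\mathcal F_\diamond$. Then the initial value problem $$\partial_\delta H_\diamond=-\{\xi H_\diamond,\,H_2+H_\diamond\},\qquad H_\diamond|_{\delta=0}=\widehat H_\diamond,$$ understood coefficient by coefficient, has a unique solution $\delta\mapsto\phi^\delta(\widehat H_\diamond)\in\mathcal F_\diamond$ on $[0,\infty)$, and there are constants $A,B>0$ and a function $g:[0,\infty)\to\mathbb R$ such that for every $\delta\ge 0$ $$\phi^\delta(\widehat H_\diamond)\in\mathcal A^{g(\delta)}\cap\mathcal F_\diamond,\qquad g(\delta)\ge\frac{A}{1+B\delta}.$$ -/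

import Mathlib

open scoped BigOperators

noncomputable section

namespace NormalizationFlow

/-- The ring `ℂ[[z₁,…,zₙ,z̄₁,…,z̄ₙ]]` of formal power series in `2n` independent variables:
the index `Sum.inl j` stands for `z_j`, the index `Sum.inr j` for `z̄_j`. -/
abbrev Series (n : ℕ) : Type := MvPowerSeries (Fin n ⊕ Fin n) ℂ

/-- Multi-indices `𝐤 = (k, k̄)`. -/
abbrev Index (n : ℕ) : Type := (Fin n ⊕ Fin n) →₀ ℕ

/-- The frequency vector is nonresonant: no nontrivial integer combination vanishes. -/
def Nonresonant {n : ℕ} (ω : Fin n → ℝ) : Prop :=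
  ∀ q : Fin n → ℤ, q ≠ 0 → ∑ j, (q j : ℝ) * ω j ≠ 0

/-- Formal power series all of whose terms have total degree at least `3`. -/
def diamondSpace (n : ℕ) : Set (Series n) :=
  {H | ∀ k : Index n, k.degree < 3 → MvPowerSeries.coeff k H = 0}

/-- The open polydisk `|z_j| < ρ`, `|z̄_j| < ρ` in `ℂ²ⁿ`. -/
def polydisk (n : ℕ) (ρ : ℝ) : Set (Fin n ⊕ Fin n → ℂ) :=
  {z | ∀ i, ‖z i‖ < ρ}

/-- The term `H_𝐤 𝐳^𝐤` of the series `H` at the point `𝐳`. -/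
def term {n : ℕ} (H : Series n) (z : Fin n ⊕ Fin n → ℂ) (k : Index n) : ℂ :=
  MvPowerSeries.coeff k H * ∏ i, z i ^ k i

/-- The space of power series that converge on the polydisk of radius `ρ` to a function
with finite supremum norm there. -/
def analyticSpace (n : ℕ) (ρ : ℝ) : Set (Series n) :=
  {H | (∀ z ∈ polydisk n ρ, Summable (term H z)) ∧
    ∃ C : ℝ, ∀ z ∈ polydisk n ρ, ‖∑' k, term H z k‖ ≤ C}

/-- The Poisson bracket `{F,G} = i ∑_j (∂_{z̄_j}F ∂_{z_j}G - ∂_{z_j}F ∂_{z̄_j}G)`. -/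
def poissonBracket {n : ℕ} (F G : Series n) : Series n :=
  Complex.I • ∑ j : Fin n,
    (MvPowerSeries.pderiv ℂ (Sum.inr j) F * MvPowerSeries.pderiv ℂ (Sum.inl j) G -
      MvPowerSeries.pderiv ℂ (Sum.inl j) F * MvPowerSeries.pderiv ℂ (Sum.inr j) G)

/-- The quadratic Hamiltonian `H₂ = ∑_j ω_j z_j z̄_j`. -/
def quadraticPart {n : ℕ} (ω : Fin n → ℝ) : Series n :=
  ∑ j : Fin n, (ω j : ℂ) • (MvPowerSeries.X (Sum.inl j) * MvPowerSeries.X (Sum.inr j))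

/-- `⟨ω, 𝐤'⟩`, where `𝐤' = k̄ - k`. -/
def frequency {n : ℕ} (ω : Fin n → ℝ) (k : Index n) : ℝ :=
  ∑ j : Fin n, ω j * ((k (Sum.inr j) : ℝ) - (k (Sum.inl j) : ℝ))

/-- The operator `ξ`, acting on coefficients by `H_𝐤 ↦ -i sign(⟨ω, 𝐤'⟩) H_𝐤`. -/
def xi {n : ℕ} (ω : Fin n → ℝ) (H : Series n) : Series n :=
  fun k => -Complex.I * (Real.sign (frequency ω k) : ℂ) * MvPowerSeries.coeff k H

/-- `γ` is a curve in the space of series of order at least `3`, defined on the set `I` of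
parameters, that solves `∂_δ H = -{ξ H, H₂ + H}` coefficientwise with `H = Hhat` at `δ = 0`. -/
structure IsSolution {n : ℕ} (ω : Fin n → ℝ) (Hhat : Series n) (I : Set ℝ)
    (γ : ℝ → Series n) : Prop where
  mem_diamondSpace : ∀ δ ∈ I, γ δ ∈ diamondSpace n
  initial : γ 0 = Hhat
  hasDeriv : ∀ δ ∈ I, ∀ k : Index n,
    HasDerivWithinAt (fun s => MvPowerSeries.coeff k (γ s))
      (MvPowerSeries.coeff k (-poissonBracket (xi ω (γ δ)) (quadraticPart ω + γ δ))) I δ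

/-- The initial value problem has a solution on `[0, ∞)`, and only one. -/
def FlowDefined {n : ℕ} (ω : Fin n → ℝ) (Hhat : Series n) : Prop :=
  ∃ γ : ℝ → Series n, IsSolution ω Hhat (Set.Ici 0) γ ∧
    ∀ γ' : ℝ → Series n, IsSolution ω Hhat (Set.Ici 0) γ' → Set.EqOn γ' γ (Set.Ici 0)

open scoped Classical in
/-- The normalization flow `φ^δ(Hhat)`: the value at `δ ≥ 0` of the unique solution
(with value `0` by convention if the initial value problem is not uniquely solvable). -/
def flow {n : ℕ} (ω : Fin n → ℝ) (δ : ℝ) (Hhat : Series n) : Series n :=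
  if h : FlowDefined ω Hhat then h.choose δ else 0

end NormalizationFlow

end

noncomputable section

namespace NormalizationFlow

open Finset

variable {n : ℕ}

/-! On coefficients the equation reads `H_k' = -|⟨ω, k̄ - k⟩| H_k + N_k(H)`, with `N(H) = -{ξH, H}`:
the sign in `ξ` turns the linear part into pure damping (`coeff_vectorField`). For series of order
at least 3, `N_k` depends only on coefficients of degree below `|k|`, since both differentiated
factors have order at least 2. The system is thus triangular in the degree: Picard iterates
stabilize coefficient by coefficient, and uniqueness follows by induction on the degree.

For analyticity, let `h_m` be the ℓ¹ norm of the degree `m` component. Damping only helps, so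
`h_m(δ)` is at most `h_m(0)` plus the integral of a convolution of the terms `j h_j` over lower
degrees. The ansatz `h_{d+3} ≤ C R^{d+3} (d+3)^{-3} (1+Bδ)^d` propagates by induction on `d`: a
derivative turns the inverse cubes into inverse squares, which are stable under convolution, and the
product of powers of `1+Bs` integrates back to `(1+Bδ)^d` when `B = 32CR²`
(`homNorm_nonlinearPart_le_of_bound`, `homNorm_picardLimit_le_of_bound`). The growth rate of `h_m`
is then linear in `δ`, so the radius decays like `1/(1+Bδ)`. -/

/-! ### Graded ℓ¹ norms and the bracket estimate. -/

/-- The multi-indices of total degree `m`. -/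
def level (n m : ℕ) : Finset (Index n) :=
  (Finsupp.finite_of_degree_eq (σ := Fin n ⊕ Fin n) m).toFinset

@[simp]
theorem mem_level {m : ℕ} {k : Index n} : k ∈ level n m ↔ k.degree = m := by
  simp [level]

/-- The `ℓ¹` norm of the homogeneous component of degree `m`. -/
def homNorm (m : ℕ) (F : Series n) : ℝ :=
  ∑ k ∈ level n m, ‖MvPowerSeries.coeff k F‖

theorem homNorm_nonneg (m : ℕ) (F : Series n) : 0 ≤ homNorm m F :=
  sum_nonneg fun _ _ => norm_nonneg _

theorem homNorm_add_le (m : ℕ) (F G : Series n) :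
    homNorm m (F + G) ≤ homNorm m F + homNorm m G := by
  unfold homNorm
  rw [← sum_add_distrib]
  exact sum_le_sum fun k _ => by rw [map_add]; exact norm_add_le _ _

theorem homNorm_neg (m : ℕ) (F : Series n) : homNorm m (-F) = homNorm m F := by
  simp [homNorm]

theorem homNorm_sub_le (m : ℕ) (F G : Series n) :
    homNorm m (F - G) ≤ homNorm m F + homNorm m G := by
  rw [sub_eq_add_neg]
  exact (homNorm_add_le m F (-G)).trans_eq (by rw [homNorm_neg])

theorem homNorm_sum_le {ι : Type*} (s : Finset ι) (m : ℕ) (F : ι → Series n) :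
    homNorm m (∑ i ∈ s, F i) ≤ ∑ i ∈ s, homNorm m (F i) := by
  unfold homNorm
  rw [sum_comm]
  exact sum_le_sum fun k _ => by rw [map_sum]; exact norm_sum_le _ _

theorem homNorm_I_smul (m : ℕ) (F : Series n) : homNorm m (Complex.I • F) = homNorm m F := by
  simp [homNorm]

theorem homNorm_mul_le (m : ℕ) (F G : Series n) :
    homNorm m (F * G) ≤ ∑ p ∈ antidiagonal m, homNorm p.1 F * homNorm p.2 G := by
  classical
  calc homNorm m (F * G)
      ≤ ∑ k ∈ level n m, ∑ a ∈ antidiagonal k,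
          ‖MvPowerSeries.coeff a.1 F‖ * ‖MvPowerSeries.coeff a.2 G‖ :=
        sum_le_sum fun k _ => by
          rw [MvPowerSeries.coeff_mul]
          exact (norm_sum_le _ _).trans_eq (sum_congr rfl fun a _ => norm_mul _ _)
    _ = ∑ p ∈ antidiagonal m, ∑ a ∈ level n p.1 ×ˢ level n p.2,
          ‖MvPowerSeries.coeff a.1 F‖ * ‖MvPowerSeries.coeff a.2 G‖ := by
        rw [sum_sigma', sum_sigma']
        refine sum_bij' (fun x _ => ⟨(x.2.1.degree, x.2.2.degree), x.2⟩)
          (fun x _ => ⟨x.2.1 + x.2.2, x.2⟩) ?_ ?_ ?_ ?_ ?_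
        · rintro ⟨k, a, b⟩ h
          simp only [mem_sigma, mem_level, HasAntidiagonal.mem_antidiagonal, mem_product] at h ⊢
          obtain ⟨rfl, rfl⟩ := h
          simp
        · rintro ⟨p, a, b⟩ h
          simp only [mem_sigma, mem_level, HasAntidiagonal.mem_antidiagonal, mem_product] at h ⊢
          simp [h.2.1, h.2.2, h.1]
        · rintro ⟨k, a, b⟩ h
          simp only [mem_sigma, mem_level, HasAntidiagonal.mem_antidiagonal] at h ⊢
          obtain ⟨rfl, rfl⟩ := h
          rfl
        · rintro ⟨⟨p, q⟩, a, b⟩ h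
          simp only [mem_sigma, mem_level, HasAntidiagonal.mem_antidiagonal, mem_product] at h ⊢
          obtain ⟨-, rfl, rfl⟩ := h
          rfl
        · intros; rfl
    _ = ∑ p ∈ antidiagonal m, homNorm p.1 F * homNorm p.2 G :=
        sum_congr rfl fun p _ => by
          unfold homNorm
          rw [sum_mul_sum, sum_product]

/-- The weight `k i` is kept inside the sum: summed over all variables it gives exactly the degree,
so no constant depending on `n` appears. -/
theorem homNorm_pderiv_le (i : Fin n ⊕ Fin n) (m : ℕ) (F : Series n) :
    homNorm m (MvPowerSeries.pderiv ℂ i F) ≤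
      ∑ k ∈ level n (m + 1), (k i : ℝ) * ‖MvPowerSeries.coeff k F‖ := by
  classical
  have h : homNorm m (MvPowerSeries.pderiv ℂ i F) =
      ∑ k ∈ (level n m).image (· + Finsupp.single i 1),
        (k i : ℝ) * ‖MvPowerSeries.coeff k F‖ := by
    rw [sum_image fun a _ b _ hab => add_right_cancel hab]
    refine sum_congr rfl fun k _ => ?_
    rw [MvPowerSeries.coeff_pderiv, norm_mul, mul_comm]
    congr 1
    have : ((k i : ℂ) + 1) = ((k i + 1 : ℕ) : ℂ) := by push_cast; rfl
    rw [this, Complex.norm_natCast]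
    simp
  rw [h]
  refine sum_le_sum_of_subset_of_nonneg ?_ fun k _ _ => by positivity
  intro k hk
  simp only [mem_image, mem_level] at hk
  obtain ⟨a, ha, rfl⟩ := hk
  simp [ha]

theorem sum_homNorm_pderiv_le (m : ℕ) (F : Series n) :
    ∑ i, homNorm m (MvPowerSeries.pderiv ℂ i F) ≤ (m + 1) * homNorm (m + 1) F := by
  refine (sum_le_sum fun i _ => homNorm_pderiv_le i m F).trans_eq ?_
  rw [sum_comm, homNorm, mul_sum]
  refine sum_congr rfl fun k hk => ?_
  rw [← sum_mul]
  congr 1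
  rw [mem_level, Finsupp.degree_eq_sum] at hk
  exact_mod_cast hk

/-- The bracket pairs each `z_j` derivative with a `z̄_j` derivative, and these pairs are among the
terms of the product of the two full sums of derivative norms. -/
theorem homNorm_poissonBracket_le (m : ℕ) (F G : Series n) :
    homNorm m (poissonBracket F G) ≤ ∑ p ∈ antidiagonal m,
      ((p.1 + 1) * homNorm (p.1 + 1) F) * ((p.2 + 1) * homNorm (p.2 + 1) G) := by
  unfold poissonBracket
  rw [homNorm_I_smul]
  have key : ∀ x y : Fin n ⊕ Fin n → ℝ, (∀ i, 0 ≤ x i) → (∀ i, 0 ≤ y i) →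
      ∑ j, (x (Sum.inr j) * y (Sum.inl j) + x (Sum.inl j) * y (Sum.inr j)) ≤
        (∑ i, x i) * ∑ i, y i := by
    intro x y hx hy
    rw [sum_add_distrib, Fintype.sum_sum_type x, Fintype.sum_sum_type y]
    have h (u v : Fin n → ℝ) (hu : ∀ i, 0 ≤ u i) (hv : ∀ i, 0 ≤ v i) :
        ∑ j, u j * v j ≤ (∑ j, u j) * ∑ j, v j := by
      rw [sum_mul]
      exact sum_le_sum fun j hj =>
        mul_le_mul_of_nonneg_left (single_le_sum (fun i _ => hv i) hj) (hu j)
    have h1 := h (fun j => x (Sum.inr j)) (fun j => y (Sum.inl j)) (fun _ => hx _) fun _ => hy _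
    have h2 := h (fun j => x (Sum.inl j)) (fun j => y (Sum.inr j)) (fun _ => hx _) fun _ => hy _
    have p1 : 0 ≤ ∑ j, x (Sum.inl j) := sum_nonneg fun _ _ => hx _
    have p2 : 0 ≤ ∑ j, x (Sum.inr j) := sum_nonneg fun _ _ => hx _
    have p3 : 0 ≤ ∑ j, y (Sum.inl j) := sum_nonneg fun _ _ => hy _
    have p4 : 0 ≤ ∑ j, y (Sum.inr j) := sum_nonneg fun _ _ => hy _
    nlinarith [mul_nonneg p1 p3, mul_nonneg p2 p4]
  refine (homNorm_sum_le _ _ _).trans ?_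
  refine (sum_le_sum fun j _ => (homNorm_sub_le _ _ _).trans
    (add_le_add (homNorm_mul_le _ _ _) (homNorm_mul_le _ _ _))).trans ?_
  simp_rw [← sum_add_distrib]
  rw [sum_comm]
  refine sum_le_sum fun p _ => ?_
  refine (key (fun i => homNorm p.1 (MvPowerSeries.pderiv ℂ i F))
    (fun i => homNorm p.2 (MvPowerSeries.pderiv ℂ i G)) (fun _ => homNorm_nonneg _ _)
    fun _ => homNorm_nonneg _ _).trans ?_
  exact mul_le_mul (sum_homNorm_pderiv_le _ _) (sum_homNorm_pderiv_le _ _)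
    (sum_nonneg fun _ _ => homNorm_nonneg _ _)
    (mul_nonneg (by positivity) (homNorm_nonneg _ _))

/-! ### Triangularity of the bracket on series of order at least 3. -/

theorem homNorm_eq_zero {H : Series n} (hH : H ∈ diamondSpace n) {m : ℕ} (hm : m < 3) :
    homNorm m H = 0 :=
  sum_eq_zero fun k hk => by rw [hH k (by rw [mem_level] at hk; omega), norm_zero]

theorem coeff_pderiv_eq_zero {F : Series n} (hF : F ∈ diamondSpace n) (i : Fin n ⊕ Fin n)
    {a : Index n} (ha : a.degree < 2) :
    MvPowerSeries.coeff a (MvPowerSeries.pderiv ℂ i F) = 0 := by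
  rw [MvPowerSeries.coeff_pderiv, hF _ (by simp; omega), zero_mul]

/-- A nonzero contribution needs degree at least 2 in each factor, hence at most `|k| - 2` in the
other; undoing the derivative raises this to `|k| - 1`. -/
theorem coeff_pderiv_mul_pderiv_congr {F F' G G' : Series n} (hF : F ∈ diamondSpace n)
    (hF' : F' ∈ diamondSpace n) (hG : G ∈ diamondSpace n) (hG' : G' ∈ diamondSpace n)
    {k : Index n} (hFF' : ∀ l : Index n, l.degree < k.degree →
      MvPowerSeries.coeff l F = MvPowerSeries.coeff l F')
    (hGG' : ∀ l : Index n, l.degree < k.degree →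
      MvPowerSeries.coeff l G = MvPowerSeries.coeff l G') (i j : Fin n ⊕ Fin n) :
    MvPowerSeries.coeff k (MvPowerSeries.pderiv ℂ i F * MvPowerSeries.pderiv ℂ j G) =
      MvPowerSeries.coeff k (MvPowerSeries.pderiv ℂ i F' * MvPowerSeries.pderiv ℂ j G') := by
  classical
  rw [MvPowerSeries.coeff_mul, MvPowerSeries.coeff_mul]
  refine sum_congr rfl fun p hp => ?_
  rw [HasAntidiagonal.mem_antidiagonal] at hp
  have hd : p.1.degree + p.2.degree = k.degree := by rw [← hp, map_add]
  by_cases h1 : p.1.degree < 2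
  · rw [coeff_pderiv_eq_zero hF i h1, coeff_pderiv_eq_zero hF' i h1, zero_mul, zero_mul]
  by_cases h2 : p.2.degree < 2
  · rw [coeff_pderiv_eq_zero hG j h2, coeff_pderiv_eq_zero hG' j h2, mul_zero, mul_zero]
  simp only [MvPowerSeries.coeff_pderiv]
  rw [hFF' _ (by simp; omega), hGG' _ (by simp; omega)]

theorem coeff_poissonBracket_congr {F F' G G' : Series n} (hF : F ∈ diamondSpace n)
    (hF' : F' ∈ diamondSpace n) (hG : G ∈ diamondSpace n) (hG' : G' ∈ diamondSpace n)
    {k : Index n} (hFF' : ∀ l : Index n, l.degree < k.degree →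
      MvPowerSeries.coeff l F = MvPowerSeries.coeff l F')
    (hGG' : ∀ l : Index n, l.degree < k.degree →
      MvPowerSeries.coeff l G = MvPowerSeries.coeff l G') :
    MvPowerSeries.coeff k (poissonBracket F G) =
      MvPowerSeries.coeff k (poissonBracket F' G') := by
  unfold poissonBracket
  simp only [map_smul, map_sum, map_sub,
    coeff_pderiv_mul_pderiv_congr hF hF' hG hG' hFF' hGG']

theorem zero_mem_diamondSpace : (0 : Series n) ∈ diamondSpace n := fun _ _ => map_zero _

theorem poissonBracket_zero (F : Series n) : poissonBracket F 0 = 0 := by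
  simp [poissonBracket]

theorem poissonBracket_add (F G H : Series n) :
    poissonBracket F (G + H) = poissonBracket F G + poissonBracket F H := by
  simp only [poissonBracket, map_add, mul_add, ← smul_add, ← sum_add_distrib]
  congr 1
  exact sum_congr rfl fun _ _ => by ring

theorem poissonBracket_mem_diamondSpace {F G : Series n} (hF : F ∈ diamondSpace n)
    (hG : G ∈ diamondSpace n) : poissonBracket F G ∈ diamondSpace n := by
  intro k hk
  rw [coeff_poissonBracket_congr hF zero_mem_diamondSpace hG zero_mem_diamondSpace
    (fun l hl => by rw [hF l (hl.trans hk), map_zero])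
    (fun l hl => by rw [hG l (hl.trans hk), map_zero]), poissonBracket_zero, map_zero]

/-! ### Coefficient form of the vector field. -/

theorem coeff_pderiv_mul_X (i : Fin n ⊕ Fin n) (F : Series n) (k : Index n) :
    MvPowerSeries.coeff k (MvPowerSeries.pderiv ℂ i F * MvPowerSeries.X i) =
      (k i : ℂ) * MvPowerSeries.coeff k F := by
  classical
  rw [MvPowerSeries.X, MvPowerSeries.coeff_mul_monomial]
  split_ifs with h
  · rw [MvPowerSeries.coeff_pderiv, tsub_add_cancel_of_le h, mul_one, mul_comm]
    congr 1
    have : 1 ≤ k i := by simpa using h i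
    simp [Nat.cast_sub this]
  · rw [Finsupp.single_le_iff] at h
    have : k i = 0 := by omega
    simp [this]

theorem pderiv_inl_quadraticPart (ω : Fin n → ℝ) (j : Fin n) :
    MvPowerSeries.pderiv ℂ (Sum.inl j) (quadraticPart ω) =
      (ω j : ℂ) • MvPowerSeries.X (Sum.inr j) := by
  classical
  simp [quadraticPart, Derivation.leibniz, MvPowerSeries.pderiv_X, Pi.single_apply,
    -Complex.coe_smul]

theorem pderiv_inr_quadraticPart (ω : Fin n → ℝ) (j : Fin n) :
    MvPowerSeries.pderiv ℂ (Sum.inr j) (quadraticPart ω) =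
      (ω j : ℂ) • MvPowerSeries.X (Sum.inl j) := by
  classical
  simp [quadraticPart, Derivation.leibniz, MvPowerSeries.pderiv_X, Pi.single_apply,
    -Complex.coe_smul]

theorem coeff_poissonBracket_quadraticPart (ω : Fin n → ℝ) (F : Series n) (k : Index n) :
    MvPowerSeries.coeff k (poissonBracket F (quadraticPart ω)) =
      Complex.I * (frequency ω k : ℂ) * MvPowerSeries.coeff k F := by
  simp only [poissonBracket, pderiv_inl_quadraticPart, pderiv_inr_quadraticPart, mul_smul_comm,
    map_smul, map_sum, map_sub, coeff_pderiv_mul_X, smul_eq_mul, frequency]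
  push_cast
  rw [mul_assoc, sum_mul]
  congr 1
  exact sum_congr rfl fun _ _ => by ring

theorem coeff_xi (ω : Fin n → ℝ) (H : Series n) (k : Index n) :
    MvPowerSeries.coeff k (xi ω H) =
      -Complex.I * (Real.sign (frequency ω k) : ℂ) * MvPowerSeries.coeff k H := rfl

theorem xi_mem_diamondSpace (ω : Fin n → ℝ) {H : Series n} (hH : H ∈ diamondSpace n) :
    xi ω H ∈ diamondSpace n := fun k hk => by rw [coeff_xi, hH k hk, mul_zero]

theorem norm_coeff_xi_le (ω : Fin n → ℝ) (H : Series n) (k : Index n) :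
    ‖MvPowerSeries.coeff k (xi ω H)‖ ≤ ‖MvPowerSeries.coeff k H‖ := by
  rw [coeff_xi, norm_mul]
  refine mul_le_of_le_one_left (norm_nonneg _) ?_
  rcases Real.sign_apply_eq (frequency ω k) with h | h | h <;> simp [h]

theorem homNorm_xi_le (ω : Fin n → ℝ) (m : ℕ) (H : Series n) :
    homNorm m (xi ω H) ≤ homNorm m H :=
  sum_le_sum fun _ _ => norm_coeff_xi_le _ _ _

/-- The nonlinear part `-{ξ H, H}` of the vector field. -/
def nonlinearPart (ω : Fin n → ℝ) (H : Series n) : Series n :=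
  -poissonBracket (xi ω H) H

theorem mul_sign_self (x : ℝ) : x * Real.sign x = |x| := by
  rcases lt_trichotomy x 0 with h | rfl | h
  · rw [Real.sign_of_neg h, abs_of_neg h, mul_neg_one]
  · simp
  · rw [Real.sign_of_pos h, abs_of_pos h, mul_one]

/-- Bracketing with `H₂` multiplies by `i⟨ω, k̄ - k⟩`, and `ξ` by `-i` times its sign; the product
is the absolute value. -/
theorem coeff_vectorField (ω : Fin n → ℝ) (H : Series n) (k : Index n) :
    MvPowerSeries.coeff k (-poissonBracket (xi ω H) (quadraticPart ω + H)) =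
      -((|frequency ω k| : ℝ) : ℂ) * MvPowerSeries.coeff k H +
        MvPowerSeries.coeff k (nonlinearPart ω H) := by
  rw [poissonBracket_add, neg_add, map_add, nonlinearPart]
  congr 1
  rw [map_neg, coeff_poissonBracket_quadraticPart, coeff_xi, ← mul_sign_self]
  push_cast
  linear_combination (frequency ω k * (Real.sign (frequency ω k)) * MvPowerSeries.coeff k H : ℂ) *
    Complex.I_mul_I

theorem nonlinearPart_mem_diamondSpace (ω : Fin n → ℝ) {H : Series n}
    (hH : H ∈ diamondSpace n) : nonlinearPart ω H ∈ diamondSpace n := fun k hk => by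
  rw [nonlinearPart, map_neg,
    poissonBracket_mem_diamondSpace (xi_mem_diamondSpace ω hH) hH k hk, neg_zero]

theorem coeff_nonlinearPart_congr (ω : Fin n → ℝ) {G H : Series n} (hG : G ∈ diamondSpace n)
    (hH : H ∈ diamondSpace n) {k : Index n} (h : ∀ l : Index n, l.degree < k.degree →
      MvPowerSeries.coeff l G = MvPowerSeries.coeff l H) :
    MvPowerSeries.coeff k (nonlinearPart ω G) = MvPowerSeries.coeff k (nonlinearPart ω H) := by
  rw [nonlinearPart, nonlinearPart, map_neg, map_neg,
    coeff_poissonBracket_congr (xi_mem_diamondSpace ω hG) (xi_mem_diamondSpace ω hH) hG hH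
      (fun l hl => by rw [coeff_xi, coeff_xi, h l hl]) h]

theorem homNorm_nonlinearPart_le (ω : Fin n → ℝ) (m : ℕ) (H : Series n) :
    homNorm m (nonlinearPart ω H) ≤ ∑ p ∈ antidiagonal m,
      ((p.1 + 1) * homNorm (p.1 + 1) H) * ((p.2 + 1) * homNorm (p.2 + 1) H) := by
  rw [nonlinearPart, homNorm_neg]
  refine (homNorm_poissonBracket_le m _ _).trans (sum_le_sum fun p _ => ?_)
  have := homNorm_nonneg (p.2 + 1) H
  gcongr
  exact homNorm_xi_le _ _ _

/-! ### Existence: Duhamel formula and Picard iteration. -/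

/-- A curve of power series all of whose coefficients are continuous. -/
def CoeffContinuous (γ : ℝ → Series n) : Prop :=
  ∀ k : Index n, Continuous fun s => MvPowerSeries.coeff k (γ s)

namespace CoeffContinuous

variable {γ γ' : ℝ → Series n}

theorem pderiv (h : CoeffContinuous γ) (i : Fin n ⊕ Fin n) :
    CoeffContinuous fun s => MvPowerSeries.pderiv ℂ i (γ s) := fun k => by
  simp only [MvPowerSeries.coeff_pderiv]
  exact (h _).mul continuous_const

theorem mul (h : CoeffContinuous γ) (h' : CoeffContinuous γ') :
    CoeffContinuous fun s => γ s * γ' s := fun k => by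
  classical
  simp only [MvPowerSeries.coeff_mul]
  exact continuous_finsetSum _ fun p _ => (h _).mul (h' _)

theorem poissonBracket (h : CoeffContinuous γ) (h' : CoeffContinuous γ') :
    CoeffContinuous fun s => poissonBracket (γ s) (γ' s) := fun k => by
  simp only [NormalizationFlow.poissonBracket, map_smul, map_sum, map_sub]
  exact (continuous_finsetSum _ fun j _ => ((h.pderiv _).mul (h'.pderiv _) k).sub
    ((h.pderiv _).mul (h'.pderiv _) k)).const_smul Complex.I

theorem nonlinearPart (h : CoeffContinuous γ) (ω : Fin n → ℝ) :
    CoeffContinuous fun s => nonlinearPart ω (γ s) := fun k => by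
  simp only [NormalizationFlow.nonlinearPart, map_neg]
  have hxi : CoeffContinuous fun s => xi ω (γ s) := fun l => by
    simp only [coeff_xi]
    exact continuous_const.mul (h l)
  exact (hxi.poissonBracket h k).neg

end CoeffContinuous

/-- The integral operator whose fixed points solve the initial value problem. -/
def duhamel (ω : Fin n → ℝ) (Hhat : Series n) (γ : ℝ → Series n) (δ : ℝ) : Series n :=
  fun k => ((Real.exp (-(|frequency ω k| * δ)) : ℝ) : ℂ) * (MvPowerSeries.coeff k Hhat +
    ∫ s in (0 : ℝ)..δ, ((Real.exp (|frequency ω k| * s) : ℝ) : ℂ) *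
      MvPowerSeries.coeff k (nonlinearPart ω (γ s)))

theorem coeff_duhamel (ω : Fin n → ℝ) (Hhat : Series n) (γ : ℝ → Series n) (δ : ℝ)
    (k : Index n) : MvPowerSeries.coeff k (duhamel ω Hhat γ δ) =
      ((Real.exp (-(|frequency ω k| * δ)) : ℝ) : ℂ) * (MvPowerSeries.coeff k Hhat +
        ∫ s in (0 : ℝ)..δ, ((Real.exp (|frequency ω k| * s) : ℝ) : ℂ) *
          MvPowerSeries.coeff k (nonlinearPart ω (γ s))) := rfl

theorem duhamel_zero (ω : Fin n → ℝ) (Hhat : Series n) (γ : ℝ → Series n) :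
    duhamel ω Hhat γ 0 = Hhat := by
  ext k
  simp [coeff_duhamel]

theorem continuous_duhamel_integrand (ω : Fin n → ℝ) {γ : ℝ → Series n}
    (h : CoeffContinuous γ) (k : Index n) :
    Continuous fun s : ℝ => ((Real.exp (|frequency ω k| * s) : ℝ) : ℂ) *
      MvPowerSeries.coeff k (nonlinearPart ω (γ s)) :=
  Continuous.mul (by fun_prop) (h.nonlinearPart ω k)

theorem hasDerivAt_coeff_duhamel (ω : Fin n → ℝ) (Hhat : Series n) {γ : ℝ → Series n}
    (h : CoeffContinuous γ) (k : Index n) (δ : ℝ) :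
    HasDerivAt (fun s => MvPowerSeries.coeff k (duhamel ω Hhat γ s))
      (-((|frequency ω k| : ℝ) : ℂ) * MvPowerSeries.coeff k (duhamel ω Hhat γ δ) +
        MvPowerSeries.coeff k (nonlinearPart ω (γ δ))) δ := by
  simp only [coeff_duhamel]
  set c := |frequency ω k|
  have h1 : HasDerivAt (fun s : ℝ => ((Real.exp (-(c * s)) : ℝ) : ℂ))
      ((Real.exp (-(c * δ)) * -(c * 1) : ℝ) : ℂ) δ :=
    (((hasDerivAt_id δ).const_mul c).neg.exp).ofReal_comp
  have hc := continuous_duhamel_integrand ω h k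
  have h2 := ((hc.integral_hasStrictDerivAt 0 δ).hasDerivAt).const_add
    (MvPowerSeries.coeff k Hhat)
  refine (h1.mul h2).congr_deriv ?_
  have he : ((Real.exp (-(c * δ)) : ℝ) : ℂ) * ((Real.exp (c * δ) : ℝ) : ℂ) = 1 := by
    rw [← Complex.ofReal_mul, ← Real.exp_add, neg_add_cancel, Real.exp_zero, Complex.ofReal_one]
  rw [← mul_assoc, he]
  push_cast
  ring

theorem CoeffContinuous.duhamel (ω : Fin n → ℝ) (Hhat : Series n) {γ : ℝ → Series n}
    (h : CoeffContinuous γ) : CoeffContinuous (duhamel ω Hhat γ) := fun k =>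
  continuous_iff_continuousAt.2 fun δ => (hasDerivAt_coeff_duhamel ω Hhat h k δ).continuousAt

theorem duhamel_mem_diamondSpace (ω : Fin n → ℝ) {Hhat : Series n} {γ : ℝ → Series n}
    (hHhat : Hhat ∈ diamondSpace n) (hγ : ∀ s, γ s ∈ diamondSpace n) (δ : ℝ) :
    duhamel ω Hhat γ δ ∈ diamondSpace n := fun k hk => by
  rw [coeff_duhamel, hHhat k hk]
  simp [nonlinearPart_mem_diamondSpace ω (hγ _) k hk]

theorem coeff_duhamel_congr (ω : Fin n → ℝ) (Hhat : Series n) {γ γ' : ℝ → Series n}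
    (hγ : ∀ s, γ s ∈ diamondSpace n) (hγ' : ∀ s, γ' s ∈ diamondSpace n) {k : Index n}
    (h : ∀ (l : Index n) (s : ℝ), l.degree < k.degree →
      MvPowerSeries.coeff l (γ s) = MvPowerSeries.coeff l (γ' s)) (δ : ℝ) :
    MvPowerSeries.coeff k (duhamel ω Hhat γ δ) = MvPowerSeries.coeff k (duhamel ω Hhat γ' δ) := by
  have (s : ℝ) : MvPowerSeries.coeff k (nonlinearPart ω (γ s)) =
      MvPowerSeries.coeff k (nonlinearPart ω (γ' s)) :=
    coeff_nonlinearPart_congr ω (hγ s) (hγ' s) fun l hl => h l s hl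
  simp only [coeff_duhamel, this]

/-- Picard iterates of the Duhamel operator. -/
def picard (ω : Fin n → ℝ) (Hhat : Series n) : ℕ → ℝ → Series n
  | 0 => fun _ => 0
  | N + 1 => duhamel ω Hhat (picard ω Hhat N)

theorem coeffContinuous_picard (ω : Fin n → ℝ) (Hhat : Series n) (N : ℕ) :
    CoeffContinuous (picard ω Hhat N) := by
  induction N with
  | zero => exact fun k => continuous_const
  | succ N ih => exact ih.duhamel ω Hhat

theorem picard_mem_diamondSpace (ω : Fin n → ℝ) {Hhat : Series n}
    (hHhat : Hhat ∈ diamondSpace n) (N : ℕ) (δ : ℝ) :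
    picard ω Hhat N δ ∈ diamondSpace n := by
  induction N generalizing δ with
  | zero => exact zero_mem_diamondSpace
  | succ N ih => exact duhamel_mem_diamondSpace ω hHhat ih δ

/-- By triangularity each iteration settles one further degree, so no contraction estimate is
needed. -/
theorem coeff_picard_succ (ω : Fin n → ℝ) {Hhat : Series n} (hHhat : Hhat ∈ diamondSpace n)
    (N : ℕ) (k : Index n) (hk : k.degree < N) (δ : ℝ) :
    MvPowerSeries.coeff k (picard ω Hhat (N + 1) δ) =
      MvPowerSeries.coeff k (picard ω Hhat N δ) := by
  induction N generalizing k δ with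
  | zero => omega
  | succ N ih =>
    exact coeff_duhamel_congr ω Hhat (picard_mem_diamondSpace ω hHhat _)
      (picard_mem_diamondSpace ω hHhat _) (fun l s hl => ih l (by omega) s) δ

/-- The power series with prescribed coefficients. -/
def ofCoeffs (f : Index n → ℂ) : Series n := f

theorem coeff_ofCoeffs (f : Index n → ℂ) (k : Index n) :
    MvPowerSeries.coeff k (ofCoeffs f) = f k := rfl

/-- The coefficientwise limit of the Picard iterates. -/
def picardLimit (ω : Fin n → ℝ) (Hhat : Series n) (δ : ℝ) : Series n :=
  ofCoeffs fun k => MvPowerSeries.coeff k (picard ω Hhat (k.degree + 1) δ)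

theorem coeff_picardLimit (ω : Fin n → ℝ) (Hhat : Series n) (δ : ℝ) (k : Index n) :
    MvPowerSeries.coeff k (picardLimit ω Hhat δ) =
      MvPowerSeries.coeff k (picard ω Hhat (k.degree + 1) δ) := by
  rw [picardLimit, coeff_ofCoeffs]

theorem coeff_picard_eq (ω : Fin n → ℝ) {Hhat : Series n} (hHhat : Hhat ∈ diamondSpace n)
    {N : ℕ} {k : Index n} (hk : k.degree < N) (δ : ℝ) :
    MvPowerSeries.coeff k (picard ω Hhat N δ) =
      MvPowerSeries.coeff k (picardLimit ω Hhat δ) := by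
  rw [coeff_picardLimit]
  induction N, hk using Nat.le_induction with
  | base => rfl
  | succ N hN ih => rw [coeff_picard_succ ω hHhat N k hN, ih]

theorem coeffContinuous_picardLimit (ω : Fin n → ℝ) (Hhat : Series n) :
    CoeffContinuous (picardLimit ω Hhat) := fun k => by
  simp only [coeff_picardLimit]
  exact coeffContinuous_picard ω Hhat _ k

theorem picardLimit_mem_diamondSpace (ω : Fin n → ℝ) {Hhat : Series n}
    (hHhat : Hhat ∈ diamondSpace n) (δ : ℝ) : picardLimit ω Hhat δ ∈ diamondSpace n :=
  fun k hk => by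
    rw [coeff_picardLimit]
    exact picard_mem_diamondSpace ω hHhat _ δ k hk

theorem duhamel_picardLimit (ω : Fin n → ℝ) {Hhat : Series n} (hHhat : Hhat ∈ diamondSpace n) :
    duhamel ω Hhat (picardLimit ω Hhat) = picardLimit ω Hhat := by
  funext δ
  ext k
  rw [coeff_picardLimit, picard]
  exact (coeff_duhamel_congr ω Hhat (picard_mem_diamondSpace ω hHhat _)
    (picardLimit_mem_diamondSpace ω hHhat) (fun l s hl => coeff_picard_eq ω hHhat hl s) δ).symm

theorem isSolution_picardLimit (ω : Fin n → ℝ) {Hhat : Series n}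
    (hHhat : Hhat ∈ diamondSpace n) :
    IsSolution ω Hhat (Set.Ici 0) (picardLimit ω Hhat) where
  mem_diamondSpace δ _ := picardLimit_mem_diamondSpace ω hHhat δ
  initial := by rw [← duhamel_picardLimit ω hHhat, duhamel_zero]
  hasDeriv δ _ k := by
    have h := hasDerivAt_coeff_duhamel ω Hhat (coeffContinuous_picardLimit ω Hhat) k δ
    rw [coeff_vectorField]
    rw [duhamel_picardLimit ω hHhat] at h
    exact h.hasDerivWithinAt

/-! ### Uniqueness and identification of the flow. -/

theorem eq_zero_of_hasDerivWithinAt_neg_mul {f : ℝ → ℂ} {c : ℝ} (h0 : f 0 = 0)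
    (hf : ∀ t ∈ Set.Ici (0 : ℝ), HasDerivWithinAt f (-(c : ℂ) * f t) (Set.Ici 0) t)
    {t : ℝ} (ht : 0 ≤ t) : f t = 0 := by
  have hd (s : ℝ) (hs : s ∈ Set.Ici (0 : ℝ)) : HasDerivWithinAt
      (fun s : ℝ => ((Real.exp (c * s) : ℝ) : ℂ) * f s) 0 (Set.Ici 0) s := by
    have h1 : HasDerivAt (fun s : ℝ => ((Real.exp (c * s) : ℝ) : ℂ))
        ((Real.exp (c * s) * (c * 1) : ℝ) : ℂ) s :=
      (((hasDerivAt_id s).const_mul c).exp).ofReal_comp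
    refine (h1.hasDerivWithinAt.mul (hf s hs)).congr_deriv ?_
    push_cast
    ring
  have hconst := constant_of_has_deriv_right_zero (a := 0) (b := t)
    (fun s hs => ((hd s hs.1).continuousWithinAt).mono Set.Icc_subset_Ici_self)
    (fun s hs => (hd s hs.1).mono (Set.Ici_subset_Ici.2 hs.1)) t ⟨ht, le_rfl⟩
  simp only [h0, mul_zero, mul_eq_zero, Complex.ofReal_eq_zero] at hconst
  exact hconst.resolve_left (Real.exp_ne_zero _)

/-- Once all lower degrees agree, the nonlinear parts cancel and the difference of two coefficients
solves a homogeneous linear equation with zero initial value. -/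
theorem IsSolution.eqOn {ω : Fin n → ℝ} {Hhat : Series n} {γ γ' : ℝ → Series n}
    (h : IsSolution ω Hhat (Set.Ici 0) γ) (h' : IsSolution ω Hhat (Set.Ici 0) γ') :
    Set.EqOn γ γ' (Set.Ici 0) := by
  suffices H : ∀ (m : ℕ) (k : Index n), k.degree = m → ∀ δ ∈ Set.Ici (0 : ℝ),
      MvPowerSeries.coeff k (γ δ) = MvPowerSeries.coeff k (γ' δ) from
    fun δ hδ => MvPowerSeries.ext fun k => H _ k rfl δ hδ
  intro m
  induction m using Nat.strong_induction_on with
  | _ m ih =>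
    rintro k rfl δ hδ
    refine sub_eq_zero.1 (eq_zero_of_hasDerivWithinAt_neg_mul (c := |frequency ω k|)
      (f := fun s => MvPowerSeries.coeff k (γ s) - MvPowerSeries.coeff k (γ' s))
      (by simp [h.initial, h'.initial]) (fun t ht => ?_) hδ)
    have := (h.hasDeriv t ht k).sub (h'.hasDeriv t ht k)
    rw [coeff_vectorField, coeff_vectorField, coeff_nonlinearPart_congr ω
      (h.mem_diamondSpace t ht) (h'.mem_diamondSpace t ht)
      (fun l hl => ih _ hl l rfl t ht)] at this
    exact this.congr_deriv (by ring)

theorem flowDefined (ω : Fin n → ℝ) {Hhat : Series n} (hHhat : Hhat ∈ diamondSpace n) :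
    FlowDefined ω Hhat :=
  ⟨_, isSolution_picardLimit ω hHhat, fun _ h => h.eqOn (isSolution_picardLimit ω hHhat)⟩

theorem flow_eq_picardLimit (ω : Fin n → ℝ) {Hhat : Series n} (hHhat : Hhat ∈ diamondSpace n)
    {δ : ℝ} (hδ : 0 ≤ δ) : flow ω δ Hhat = picardLimit ω Hhat δ := by
  have h := flowDefined ω hHhat
  rw [flow, dif_pos h]
  exact h.choose_spec.1.eqOn (isSolution_picardLimit ω hHhat) hδ

/-! ### Majorant estimate along the flow. -/

/-- The damping factors `exp(-|⟨ω, k̄ - k⟩|(δ - s))` are at most 1 for `0 ≤ s ≤ δ`. -/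
theorem norm_coeff_duhamel_le (ω : Fin n → ℝ) (Hhat : Series n) {γ : ℝ → Series n}
    (h : CoeffContinuous γ) (k : Index n) {δ : ℝ} (hδ : 0 ≤ δ) :
    ‖MvPowerSeries.coeff k (duhamel ω Hhat γ δ)‖ ≤ ‖MvPowerSeries.coeff k Hhat‖ +
      ∫ s in (0 : ℝ)..δ, ‖MvPowerSeries.coeff k (nonlinearPart ω (γ s))‖ := by
  rw [coeff_duhamel, mul_add, ← intervalIntegral.integral_const_mul]
  refine (norm_add_le _ _).trans (add_le_add ?_ ?_)
  · rw [norm_mul, Complex.norm_real, Real.norm_eq_abs, Real.abs_exp]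
    refine mul_le_of_le_one_left (norm_nonneg _) (Real.exp_le_one_iff.2 ?_)
    have := mul_nonneg (abs_nonneg (frequency ω k)) hδ
    linarith
  · refine (intervalIntegral.norm_integral_le_integral_norm hδ).trans ?_
    have hc := (continuous_duhamel_integrand ω h k).const_smul
      ((Real.exp (-(|frequency ω k| * δ)) : ℝ) : ℂ)
    refine intervalIntegral.integral_mono_on hδ (hc.norm.intervalIntegrable _ _)
      ((h.nonlinearPart ω k).norm.intervalIntegrable _ _) fun s hs => ?_
    rw [← mul_assoc, ← Complex.ofReal_mul, ← Real.exp_add, norm_mul, Complex.norm_real,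
      Real.norm_eq_abs, Real.abs_exp]
    refine mul_le_of_le_one_left (norm_nonneg _) (Real.exp_le_one_iff.2 ?_)
    have := mul_le_mul_of_nonneg_left hs.2 (abs_nonneg (frequency ω k))
    linarith

theorem CoeffContinuous.homNorm {γ : ℝ → Series n} (h : CoeffContinuous γ) (m : ℕ) :
    Continuous fun s => homNorm m (γ s) :=
  continuous_finsetSum _ fun k _ => (h k).norm

theorem homNorm_picardLimit_le (ω : Fin n → ℝ) {Hhat : Series n}
    (hHhat : Hhat ∈ diamondSpace n) (m : ℕ) {δ : ℝ} (hδ : 0 ≤ δ) :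
    homNorm m (picardLimit ω Hhat δ) ≤ homNorm m Hhat +
      ∫ s in (0 : ℝ)..δ, homNorm m (nonlinearPart ω (picardLimit ω Hhat s)) := by
  have hc := coeffContinuous_picardLimit ω Hhat
  unfold homNorm
  rw [intervalIntegral.integral_finsetSum fun k _ =>
    (hc.nonlinearPart ω k).norm.intervalIntegrable _ _, ← sum_add_distrib]
  refine sum_le_sum fun k _ => ?_
  have := norm_coeff_duhamel_le ω Hhat hc k hδ
  rwa [duhamel_picardLimit ω hHhat] at this

theorem sum_range_inv_sq_le (N : ℕ) : ∑ p ∈ range (N + 1), (1 : ℝ) / ((p : ℝ) + 1) ^ 2 ≤ 2 := by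
  -- The sharper bound lets the induction telescope.
  suffices h : ∑ p ∈ range (N + 1), (1 : ℝ) / ((p : ℝ) + 1) ^ 2 ≤ 2 - 1 / ((N : ℝ) + 1) from
    h.trans (sub_le_self _ (by positivity))
  induction N with
  | zero => norm_num
  | succ N ih =>
    rw [sum_range_succ]
    push_cast
    have h : (1 : ℝ) / ((N : ℝ) + 1 + 1) ^ 2 ≤ 1 / ((N : ℝ) + 1) - 1 / ((N : ℝ) + 1 + 1) := by
      rw [div_sub_div _ _ (by positivity) (by positivity),
        div_le_div_iff₀ (by positivity) (by positivity)]
      nlinarith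
    linarith

/-- From `(x + y)² ≤ 2(x² + y²)` one gets `1/(x²y²) ≤ 2(x + y)⁻²(1/x² + 1/y²)`, with `x + y = m + 2`
constant along the antidiagonal. -/
theorem sum_antidiagonal_inv_sq_mul_inv_sq_le (m : ℕ) :
    ∑ p ∈ antidiagonal m, (1 : ℝ) / (((p.1 : ℝ) + 1) ^ 2 * ((p.2 : ℝ) + 1) ^ 2) ≤
      8 / ((m : ℝ) + 2) ^ 2 := by
  have h1 : ∑ p ∈ antidiagonal m, (1 : ℝ) / ((p.1 : ℝ) + 1) ^ 2 ≤ 2 := by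
    rw [Nat.sum_antidiagonal_eq_sum_range_succ_mk]
    exact sum_range_inv_sq_le m
  have h2 : ∑ p ∈ antidiagonal m, (1 : ℝ) / ((p.2 : ℝ) + 1) ^ 2 ≤ 2 := by
    rw [← Nat.sum_antidiagonal_swap]
    exact h1
  calc ∑ p ∈ antidiagonal m, (1 : ℝ) / (((p.1 : ℝ) + 1) ^ 2 * ((p.2 : ℝ) + 1) ^ 2)
      ≤ ∑ p ∈ antidiagonal m, 2 / ((m : ℝ) + 2) ^ 2 *
          (1 / ((p.1 : ℝ) + 1) ^ 2 + 1 / ((p.2 : ℝ) + 1) ^ 2) := by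
        refine sum_le_sum fun p hp => ?_
        rw [HasAntidiagonal.mem_antidiagonal] at hp
        have hm : (m : ℝ) + 2 = ((p.1 : ℝ) + 1) + ((p.2 : ℝ) + 1) := by
          rw [← hp]; push_cast; ring
        rw [hm]
        have hx : 0 < (p.1 : ℝ) + 1 := by positivity
        have hy : 0 < (p.2 : ℝ) + 1 := by positivity
        generalize (p.1 : ℝ) + 1 = x at *
        generalize (p.2 : ℝ) + 1 = y at *
        rw [div_add_div _ _ (by positivity) (by positivity), div_mul_div_comm,
          div_le_div_iff₀ (by positivity) (by positivity)]
        have : (x + y) ^ 2 ≤ 2 * (x ^ 2 + y ^ 2) := by nlinarith [sq_nonneg (x - y)]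
        nlinarith [mul_le_mul_of_nonneg_right this (by positivity : 0 ≤ x ^ 2 * y ^ 2)]
    _ = 2 / ((m : ℝ) + 2) ^ 2 * (∑ p ∈ antidiagonal m, (1 : ℝ) / ((p.1 : ℝ) + 1) ^ 2 +
          ∑ p ∈ antidiagonal m, (1 : ℝ) / ((p.2 : ℝ) + 1) ^ 2) := by
        rw [← mul_sum, sum_add_distrib]
    _ ≤ 2 / ((m : ℝ) + 2) ^ 2 * (2 + 2) := by gcongr
    _ = 8 / ((m : ℝ) + 2) ^ 2 := by ring

/-- The right side has the shape `K · d u^(d-1) · B`, the derivative of `K u^d` along `u = 1 + Bs`;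
this dictates `B = 32CR²`. -/
theorem homNorm_nonlinearPart_le_of_bound (ω : Fin n → ℝ) {H : Series n}
    (hH : H ∈ diamondSpace n) {C R u : ℝ} (hC : 0 ≤ C) (hR : 0 ≤ R) (hu : 0 ≤ u) (d : ℕ)
    (h : ∀ e < d, homNorm (e + 3) H ≤ C * R ^ (e + 3) / ((e : ℝ) + 3) ^ 3 * u ^ e) :
    homNorm (d + 3) (nonlinearPart ω H) ≤ C * R ^ (d + 3) / ((d : ℝ) + 3) ^ 3 *
      (d * u ^ (d - 1) * (32 * C * R ^ 2)) := by
  refine (homNorm_nonlinearPart_le ω (d + 3) H).trans ?_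
  -- For `d = 0` every term vanishes: nonzero terms need `p, q ≥ 2`, but `p + q = 3`. The case split
  -- also neutralizes the truncated `d - 1`.
  have hterm : ∀ p ∈ antidiagonal (d + 3),
      (((p.1 : ℝ) + 1) * homNorm (p.1 + 1) H) * (((p.2 : ℝ) + 1) * homNorm (p.2 + 1) H) ≤
        (if d = 0 then 0 else C ^ 2 * R ^ (d + 5) * u ^ (d - 1)) *
          (1 / (((p.1 : ℝ) + 1) ^ 2 * ((p.2 : ℝ) + 1) ^ 2)) := by
    rintro ⟨p, q⟩ hpq
    rw [HasAntidiagonal.mem_antidiagonal] at hpq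
    simp only at hpq ⊢
    have hpos : 0 ≤ (if d = 0 then 0 else C ^ 2 * R ^ (d + 5) * u ^ (d - 1)) *
          (1 / (((p : ℝ) + 1) ^ 2 * ((q : ℝ) + 1) ^ 2)) := by
      split_ifs <;> positivity
    by_cases hp : p < 2
    · rwa [homNorm_eq_zero hH (by omega : p + 1 < 3), mul_zero, zero_mul]
    by_cases hq : q < 2
    · rwa [homNorm_eq_zero hH (by omega : q + 1 < 3), mul_zero, mul_zero]
    obtain ⟨a, rfl⟩ : ∃ a, p = a + 2 := ⟨p - 2, by omega⟩
    obtain ⟨b, rfl⟩ : ∃ b, q = b + 2 := ⟨q - 2, by omega⟩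
    -- The bracket loses two degrees, `(a + 3) + (b + 3) = (d + 3) + 2`, whence `u^a u^b = u^(d-1)`.
    obtain rfl : d = a + b + 1 := by omega
    have ha := h a (by omega)
    have hb := h b (by omega)
    have key (c : ℕ) (hc : homNorm (c + 3) H ≤ C * R ^ (c + 3) / ((c : ℝ) + 3) ^ 3 * u ^ c) :
        (((c + 2 : ℕ) : ℝ) + 1) * homNorm (c + 2 + 1) H ≤
          C * R ^ (c + 3) * u ^ c * (1 / (((c + 2 : ℕ) : ℝ) + 1) ^ 2) := by
      have h3 : ((c + 2 : ℕ) : ℝ) + 1 = (c : ℝ) + 3 := by push_cast; ring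
      rw [h3]
      refine (mul_le_mul_of_nonneg_left hc (by positivity)).trans_eq ?_
      field_simp
    refine (mul_le_mul (key a ha) (key b hb)
      (mul_nonneg (by positivity) (homNorm_nonneg _ _)) (by positivity)).trans_eq ?_
    rw [if_neg (by omega), Nat.add_sub_cancel, one_div_mul_one_div_rev .. |>.symm]
    ring
  refine (sum_le_sum hterm).trans ?_
  rw [← mul_sum]
  rcases Nat.eq_zero_or_pos d with rfl | hd
  · simp
  rw [if_neg hd.ne']
  refine (mul_le_mul_of_nonneg_left (sum_antidiagonal_inv_sq_mul_inv_sq_le _)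
    (by positivity)).trans ?_
  have hd1 : (1 : ℝ) ≤ d := by exact_mod_cast hd
  -- Here `d + 3 ≤ 4d` because `d ≥ 1`; this is the factor `32 = 8 · 4`.
  have hfrac : 8 / (((d + 3 : ℕ) : ℝ) + 2) ^ 2 ≤ 32 * d / ((d : ℝ) + 3) ^ 3 := by
    push_cast
    rw [div_le_div_iff₀ (by positivity) (by positivity)]
    nlinarith [sq_nonneg ((d : ℝ) + 3), mul_nonneg (sub_nonneg.2 hd1) (sq_nonneg ((d : ℝ) + 3))]
  refine (mul_le_mul_of_nonneg_left hfrac (by positivity)).trans_eq ?_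
  field_simp
  ring

theorem homNorm_picardLimit_le_of_bound (ω : Fin n → ℝ) {Hhat : Series n}
    (hHhat : Hhat ∈ diamondSpace n) {C R : ℝ} (hC : 0 ≤ C) (hR : 0 ≤ R)
    (h0 : ∀ d : ℕ, homNorm (d + 3) Hhat ≤ C * R ^ (d + 3) / ((d : ℝ) + 3) ^ 3) (d : ℕ)
    {δ : ℝ} (hδ : 0 ≤ δ) :
    homNorm (d + 3) (picardLimit ω Hhat δ) ≤
      C * R ^ (d + 3) / ((d : ℝ) + 3) ^ 3 * (1 + 32 * C * R ^ 2 * δ) ^ d := by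
  induction d using Nat.strong_induction_on generalizing δ with
  | _ d ih =>
    set B := 32 * C * R ^ 2 with hB
    have hB0 : 0 ≤ B := by positivity
    set K := C * R ^ (d + 3) / ((d : ℝ) + 3) ^ 3 with hK
    have hcont : Continuous fun s : ℝ => K * (d * (1 + B * s) ^ (d - 1) * B) := by fun_prop
    calc homNorm (d + 3) (picardLimit ω Hhat δ)
        ≤ homNorm (d + 3) Hhat +
          ∫ s in (0 : ℝ)..δ, homNorm (d + 3) (nonlinearPart ω (picardLimit ω Hhat s)) :=
          homNorm_picardLimit_le ω hHhat _ hδ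
      _ ≤ K + ∫ s in (0 : ℝ)..δ, K * (d * (1 + B * s) ^ (d - 1) * B) := by
          refine add_le_add (h0 d) (intervalIntegral.integral_mono_on hδ ?_
            (hcont.intervalIntegrable _ _) fun s hs => ?_)
          · exact (((coeffContinuous_picardLimit ω Hhat).nonlinearPart ω).homNorm
              _).intervalIntegrable _ _
          · have := mul_nonneg hB0 hs.1
            exact homNorm_nonlinearPart_le_of_bound ω (picardLimit_mem_diamondSpace ω hHhat s)
              hC hR (by positivity) d fun e he => ih e he hs.1
      _ = K + (K * (1 + B * δ) ^ d - K * (1 + B * 0) ^ d) := by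
          congr 1
          refine intervalIntegral.integral_eq_sub_of_hasDerivAt
            (f := fun s => K * (1 + B * s) ^ d) (fun s _ => ?_) (hcont.intervalIntegrable _ _)
          have hlin : HasDerivAt (fun s : ℝ => 1 + B * s) B s := by
            simpa using ((hasDerivAt_id s).const_mul B).const_add 1
          exact (hlin.pow d).const_mul K
      _ = K * (1 + B * δ) ^ d := by simp

/-! ### Graded norms versus convergence on polydisks. -/

theorem norm_term (H : Series n) (z : Fin n ⊕ Fin n → ℂ) (k : Index n) :
    ‖term H z k‖ = ‖MvPowerSeries.coeff k H‖ * ∏ i, ‖z i‖ ^ k i := by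
  simp [term]

theorem norm_term_le (H : Series n) {z : Fin n ⊕ Fin n → ℂ} {r : ℝ} (hz : z ∈ polydisk n r)
    (k : Index n) : ‖term H z k‖ ≤ ‖MvPowerSeries.coeff k H‖ * r ^ k.degree := by
  rw [norm_term, Finsupp.degree_eq_sum, ← prod_pow_eq_pow_sum]
  refine mul_le_mul_of_nonneg_left (prod_le_prod (fun i _ => by positivity) fun i _ => ?_)
    (norm_nonneg _)
  have := (hz i).le
  gcongr

/-- At radius `1/(2Q)` the degree `m` part contributes at most `C 2^(-m)`; grouping a finite set of
indices by degree gives the uniform bound `2C`. -/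
theorem summable_coeff_of_homNorm_le {H : Series n} {C Q : ℝ} (hC : 0 ≤ C) (hQ : 0 < Q)
    (h : ∀ m, homNorm m H ≤ C * Q ^ m) :
    Summable fun k : Index n => ‖MvPowerSeries.coeff k H‖ * (1 / (2 * Q)) ^ k.degree := by
  classical
  refine summable_of_sum_le (c := C * 2) (fun k => by positivity) fun s => ?_
  obtain ⟨M, hM⟩ : ∃ M, ∀ k ∈ s, k.degree < M :=
    ⟨s.sup Finsupp.degree + 1, fun k hk => Nat.lt_succ_of_le (le_sup (f := Finsupp.degree) hk)⟩
  calc ∑ k ∈ s, ‖MvPowerSeries.coeff k H‖ * (1 / (2 * Q)) ^ k.degree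
      ≤ ∑ k ∈ (range M).biUnion (level n),
          ‖MvPowerSeries.coeff k H‖ * (1 / (2 * Q)) ^ k.degree :=
        sum_le_sum_of_subset_of_nonneg (fun k hk => by simpa using hM k hk)
          fun k _ _ => by positivity
    _ = ∑ m ∈ range M, ∑ k ∈ level n m,
          ‖MvPowerSeries.coeff k H‖ * (1 / (2 * Q)) ^ k.degree := by
        refine sum_biUnion fun a _ b _ hab => disjoint_left.2 fun k hka hkb => hab ?_
        rw [mem_level] at hka hkb
        rw [← hka, ← hkb]
    _ = ∑ m ∈ range M, homNorm m H * (1 / (2 * Q)) ^ m := by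
        refine sum_congr rfl fun m _ => ?_
        rw [homNorm, sum_mul]
        exact sum_congr rfl fun k hk => by rw [mem_level.1 hk]
    _ ≤ ∑ m ∈ range M, C * (1 / 2) ^ m := by
        refine sum_le_sum fun m _ => ?_
        refine (mul_le_mul_of_nonneg_right (h m) (by positivity)).trans_eq ?_
        rw [mul_assoc, ← mul_pow]
        congr 2
        field_simp
    _ ≤ C * 2 := by
        rw [← mul_sum]
        exact mul_le_mul_of_nonneg_left (sum_geometric_two_le M) hC

theorem mem_analyticSpace_of_homNorm_le {H : Series n} {C Q : ℝ} (hC : 0 ≤ C) (hQ : 0 < Q)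
    (h : ∀ m, homNorm m H ≤ C * Q ^ m) : H ∈ analyticSpace n (1 / (2 * Q)) := by
  have hs := summable_coeff_of_homNorm_le hC hQ h
  exact ⟨fun z hz => Summable.of_norm_bounded hs (norm_term_le H hz),
    _, fun z hz => tsum_of_norm_bounded hs.hasSum (norm_term_le H hz)⟩

/-- Summability in `ℂ` is absolute, so evaluating at the single point with all coordinates `ρ/2`
controls every graded norm at once. -/
theorem exists_homNorm_le_of_mem_analyticSpace {H : Series n} {ρ : ℝ} (hρ : 0 < ρ)
    (hH : H ∈ analyticSpace n ρ) : ∃ C, 0 ≤ C ∧ ∀ m, homNorm m H ≤ C * (2 / ρ) ^ m := by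
  set z : Fin n ⊕ Fin n → ℂ := fun _ => ((ρ / 2 : ℝ) : ℂ) with hz
  have hnz (i : Fin n ⊕ Fin n) : ‖z i‖ = ρ / 2 := by
    rw [hz, Complex.norm_real, Real.norm_of_nonneg (by positivity)]
  have hs := (hH.1 z fun i => (hnz i).trans_lt (half_lt_self hρ)).norm
  refine ⟨∑' k, ‖term H z k‖, tsum_nonneg fun _ => norm_nonneg _, fun m => ?_⟩
  have hle := hs.sum_le_tsum (level n m) fun _ _ => norm_nonneg _
  have heq : ∑ k ∈ level n m, ‖term H z k‖ = homNorm m H * (ρ / 2) ^ m := by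
    rw [homNorm, sum_mul]
    refine sum_congr rfl fun k hk => ?_
    rw [norm_term, ← mem_level.1 hk, Finsupp.degree_eq_sum, ← prod_pow_eq_pow_sum]
    simp only [hnz]
  rw [heq] at hle
  calc homNorm m H = homNorm m H * (ρ / 2) ^ m * (2 / ρ) ^ m := by
        rw [mul_assoc, ← mul_pow, div_mul_div_cancel₀' hρ.ne', div_self two_ne_zero, one_pow,
          mul_one]
    _ ≤ _ := mul_le_mul_of_nonneg_right hle (by positivity)

theorem exists_homNorm_le_div_cube {H : Series n} {ρ : ℝ} (hρ : 0 < ρ)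
    (hH : H ∈ analyticSpace n ρ) : ∃ C R : ℝ, 0 < C ∧ 0 < R ∧
      ∀ d : ℕ, homNorm (d + 3) H ≤ C * R ^ (d + 3) / ((d : ℝ) + 3) ^ 3 := by
  obtain ⟨C, hC, h⟩ := exists_homNorm_le_of_mem_analyticSpace hρ hH
  -- The factor `8^m` absorbs the cube through `m ≤ 2^m`; adding 1 makes the constant strictly
  -- positive.
  refine ⟨C + 1, 8 * (2 / ρ), by positivity, by positivity, fun d => (h _).trans ?_⟩
  have hpow : ((d : ℝ) + 3) ^ 3 ≤ 8 ^ (d + 3) := by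
    have h2 : ((d : ℝ) + 3) ≤ 2 ^ (d + 3) := by
      exact_mod_cast (Nat.lt_two_pow_self (n := d + 3)).le
    calc ((d : ℝ) + 3) ^ 3 ≤ (2 ^ (d + 3)) ^ 3 := by gcongr
      _ = 8 ^ (d + 3) := by rw [← pow_mul, mul_comm, pow_mul]; norm_num
  rw [le_div_iff₀ (by positivity), mul_pow, mul_assoc, mul_comm ((2 / ρ) ^ (d + 3))]
  gcongr
  linarith

theorem homNorm_picardLimit_le_geometric (ω : Fin n → ℝ) {Hhat : Series n}
    (hHhat : Hhat ∈ diamondSpace n) {C R : ℝ} (hC : 0 < C) (hR : 0 < R)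
    (h0 : ∀ d : ℕ, homNorm (d + 3) Hhat ≤ C * R ^ (d + 3) / ((d : ℝ) + 3) ^ 3)
    {δ : ℝ} (hδ : 0 ≤ δ) (m : ℕ) :
    homNorm m (picardLimit ω Hhat δ) ≤ C * (R * (1 + 32 * C * R ^ 2 * δ)) ^ m := by
  have hu : 1 ≤ 1 + 32 * C * R ^ 2 * δ := le_add_of_nonneg_right (by positivity)
  by_cases hm : m < 3
  · rw [homNorm_eq_zero (picardLimit_mem_diamondSpace ω hHhat δ) hm]
    positivity
  obtain ⟨d, rfl⟩ : ∃ d, m = d + 3 := ⟨m - 3, by omega⟩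
  refine (homNorm_picardLimit_le_of_bound ω hHhat hC.le hR.le h0 d hδ).trans ?_
  rw [mul_pow, ← mul_assoc]
  refine mul_le_mul (div_le_self (by positivity) (one_le_pow₀ ?_))
    (pow_le_pow_right₀ hu (by omega)) (by positivity) (by positivity)
  have : (0 : ℝ) ≤ d := d.cast_nonneg
  linarith

end NormalizationFlow

end

open NormalizationFlow in
theorem mainTheorem2 (n : ℕ) (ω : Fin n → ℝ) (hω : Nonresonant ω)
    (ρ : ℝ) (hρ : 0 < ρ) (Hhat : Series n)
    (hHhat : Hhat ∈ analyticSpace n ρ ∩ diamondSpace n) :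
    FlowDefined ω Hhat ∧
      ∃ A B : ℝ, 0 < A ∧ 0 < B ∧
        ∃ g : ℝ → ℝ, ∀ δ : ℝ, 0 ≤ δ →
          A / (1 + B * δ) ≤ g δ ∧
            flow ω δ Hhat ∈ analyticSpace n (g δ) ∩ diamondSpace n := by
  obtain ⟨C, R, hC, hR, h0⟩ := exists_homNorm_le_div_cube hρ hHhat.1
  -- The graded norms grow at rate `Q = R(1 + 32CR²δ)`, and the radius `1/(2Q)` equals `A/(1 + Bδ)`
  -- exactly.
  refine ⟨flowDefined ω hHhat.2, 1 / (2 * R), 32 * C * R ^ 2, by positivity, by positivity,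
    fun δ => 1 / (2 * (R * (1 + 32 * C * R ^ 2 * δ))), fun δ hδ => ⟨?_, ?_⟩⟩
  · rw [div_div, mul_assoc 2]
  · rw [flow_eq_picardLimit ω hHhat.2 hδ]
    exact ⟨mem_analyticSpace_of_homNorm_le hC.le (by positivity)
      (homNorm_picardLimit_le_geometric ω hHhat.2 hC hR h0 hδ),
      picardLimit_mem_diamondSpace ω hHhat.2 δ⟩
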